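/- All graphs are finite. An oriented graph is a directed graph without loops and with at most one arc between any two vertices. The inversion of a set $X$ of vertices in an oriented graph $D$ reverses every arc of $D$ with both ends in $X$, and the inversion number $\operatorname{inv}(D)$ is the least $m\ge 0$ such that some $X_1,\dots,X_m\subseteq V(D)$, inverted one after another, turn $D$ into an oriented graph without directed cycles. The dijoin $D\to E$ is the disjoint union of $D$ and $E$ together with all arcs from vertices of $D$ to vertices of $E$; the $n$-join $[D_1,\dots,D_n]$ is obtained by successive dijoins, i.e. it is the disjoint union of $D_1,\dots,D_n$ together with all arcs from $D_i$ to $D_k$ for $i<k$. Let $\overrightarrow{C_3}$ be the directed cycle on three vertices. Theorem. Let $n\ge 2$, let $D_1,\dots,D_n$ be oriented graphs and let $j\in\{1,\dots,n\}$ be such that $\operatorname{inv}(D_i)\le 2$ for all $i\ne j$ (no condition on $\operatorname{inv}(D_j)$). Then $$\operatorname{inv}([D_1,\dots,D_n])=\begin{cases}\displaystyle\sum_{i=1}^n\operatorname{inv}(D_i)-1 & \text{if } \operatorname{inv}(\overrightarrow{C_3}\to D_j)=\operatorname{inv}(D_j)\text{ and }\operatorname{inv}(D_i)\ge 1\text{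 for some } i\ne j,\\[2mm] \displaystyle\sum_{i=1}^n\operatorname{inv}(D_i) & \text{otherwise.}\end{cases}$$ In particular (Conjecture 9 of Alon, Powierski, Savery, Scott and Wilmer), for every $n\in\mathbb N$ and all oriented graphs $D_1,\dots,D_n$ with $\operatorname{inv}(D_i)\le 2$ for all $i$, one has $\operatorname{inv}([D_1,\dots,D_n])=\sum_{i=1}^n\operatorname{inv}(D_i)$. -/

import Mathlib

/-- A simple oriented graph on the vertex set `V`: a digraph with no loops and at most one arc
between any two vertices (both follow from asymmetry of the arc relation). -/
structure OrientedGraph (V : Type*) extends Digraph V where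
  asymm : ∀ u v : V, Adj u v → ¬ Adj v u

namespace OrientedGraph

/-- The inversion of `X` in `D`: the arcs with both ends in `X` are reversed, all others kept. -/
def invert {V : Type*} (D : OrientedGraph V) (X : Set V) : OrientedGraph V where
  Adj u v := ((u ∈ X ∧ v ∈ X) ∧ D.Adj v u) ∨ (¬ (u ∈ X ∧ v ∈ X) ∧ D.Adj u v)
  asymm u v := by
    have h1 := D.asymm u v
    have h2 := D.asymm v u
    tauto

/-- The inversion of a family `X₁, …, Xₘ`: the sets are inverted one after another. -/
def invertFamily {V : Type*} (D : OrientedGraph V) (F : List (Set V)) : OrientedGraph V :=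
  F.foldl invert D

/-- `D` contains no directed cycle: no vertex can be reached from itself along a nonempty
directed walk. -/
def IsAcyclic {V : Type*} (D : OrientedGraph V) : Prop :=
  ∀ v : V, ¬ Relation.TransGen D.Adj v v

/-- `F` is a decycling family for `D`. -/
def IsDecyclingFamily {V : Type*} (D : OrientedGraph V) (F : List (Set V)) : Prop :=
  (D.invertFamily F).IsAcyclic

/-- On a finite vertex set every oriented graph has a decycling family. -/
theorem exists_isDecyclingFamily {V : Type*} [Finite V] (D : OrientedGraph V) :
    ∃ F : List (Set V), D.IsDecyclingFamily F := by
  obtain ⟨k, ⟨r⟩⟩ := Finite.exists_equiv_fin V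
  suffices H : ∀ (N : ℕ) (D : OrientedGraph V),
      {p : V × V | D.Adj p.1 p.2 ∧ r p.2 ≤ r p.1}.ncard = N →
        ∃ F : List (Set V), ∀ u v, (D.invertFamily F).Adj u v → r u < r v by
    obtain ⟨F, hF⟩ := H _ D rfl
    refine ⟨F, fun v hv => ?_⟩
    have key : ∀ u w, Relation.TransGen (D.invertFamily F).Adj u w → r u < r w := by
      intro u w h
      induction h with
      | single h => exact hF _ _ h
      | tail _ h ih => exact ih.trans (hF _ _ h)
    exact lt_irrefl _ (key v v hv)
  intro N
  induction N using Nat.strong_induction_on with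
  | _ N ih =>
    intro D hN
    by_cases hD : ∀ u v, D.Adj u v → r u < r v
    · exact ⟨[], hD⟩
    · push Not at hD
      obtain ⟨a, b, hab, hle⟩ := hD
      have hlt : r b < r a := by
        refine lt_of_le_of_ne hle fun h => ?_
        obtain rfl := r.injective h
        exact D.asymm _ _ hab hab
      obtain ⟨F, hF⟩ := ih _ (by
        rw [← hN]
        refine Set.ncard_lt_ncard (t := {p : V × V | D.Adj p.1 p.2 ∧ r p.2 ≤ r p.1}) ?_
          (Set.toFinite _)
        refine ⟨?_, fun h => ?_⟩
        · rintro ⟨u, v⟩ ⟨h1 | h1, h2⟩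
          · obtain ⟨⟨hu, hv⟩, h1⟩ := h1
            dsimp only at hu hv h1 h2
            have h3 := D.asymm a b hab
            have h4 : ∀ x, ¬ D.Adj x x := fun x hx => D.asymm x x hx hx
            rcases hu with rfl | rfl <;> rcases hv with rfl | rfl
            · exact absurd h1 (h4 _)
            · exact absurd h1 h3
            · exact absurd h2 (not_le.2 hlt)
            · exact absurd h1 (h4 _)
          · exact ⟨h1.2, h2⟩
        · have h5 := h (a := (a, b)) ⟨hab, hle⟩
          have h3 := D.asymm a b hab
          rcases h5.1 with h6 | h6
          · exact h3 h6.2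
          · exact h6.1 ⟨Or.inl rfl, Or.inr rfl⟩) (D.invert {a, b}) rfl
      exact ⟨{a, b} :: F, hF⟩

/-- The inversion number: the least `m` for which `D` has a decycling family of `m` sets. (On a
finite vertex set such a family exists, so the infimum is a minimum.) -/
noncomputable def inv {V : Type*} (D : OrientedGraph V) : ℕ :=
  sInf {m : ℕ | ∃ F : List (Set V), F.length = m ∧ D.IsDecyclingFamily F}

/-- The dijoin `D → E`: the disjoint union of `D` and `E` with all arcs from `D` to `E` added. -/
def dijoin {V W : Type*} (D : OrientedGraph V) (E : OrientedGraph W) : OrientedGraph (V ⊕ W) where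
  Adj := Sum.Lex D.Adj E.Adj
  asymm := by
    rintro (u | u) (v | v) h
    · simpa using D.asymm u v (by simpa using h)
    · simp
    · simp at h
    · simpa using E.asymm u v (by simpa using h)

/-- The `n`-join `[D₁, …, Dₙ]`: the disjoint union of the `Dᵢ` with all arcs from `Dᵢ` to `Dₖ`
added whenever `i < k`. -/
def nJoin {n : ℕ} {V : Fin n → Type*} (D : (i : Fin n) → OrientedGraph (V i)) :
    OrientedGraph ((i : Fin n) × V i) where
  Adj := Sigma.Lex (· < ·) (fun i => (D i).Adj)
  asymm := by
    rintro _ _ (⟨a, b, h⟩ | ⟨a, b, h⟩) (⟨_, _, h'⟩ | ⟨_, _, h'⟩)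
    · exact lt_asymm h h'
    · exact lt_irrefl _ h
    · exact lt_irrefl _ h'
    · exact (D _).asymm _ _ h h'

/-- The directed cycle `0 → 1 → 2 → 0` on three vertices. -/
def C3 : OrientedGraph (Fin 3) where
  Adj u v := v = u + 1
  asymm := by decide

/-- The `n`-join is obtained by taking successive dijoins: up to the obvious bijection of the
vertices, `[D₁, …, Dₙ₊₁]` is the dijoin `[D₁, …, Dₙ] → Dₙ₊₁`. -/
theorem nJoin_succ {n : ℕ} {V : Fin (n + 1) → Type*}
    (D : (i : Fin (n + 1)) → OrientedGraph (V i)) :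
    ∃ e : ((i : Fin n) × V i.castSucc) ⊕ V (Fin.last n) ≃ ((i : Fin (n + 1)) × V i),
      (∀ i v, e (Sum.inl ⟨i, v⟩) = ⟨i.castSucc, v⟩) ∧
      (∀ v, e (Sum.inr v) = ⟨Fin.last n, v⟩) ∧
      ∀ x y, (nJoin D).Adj (e x) (e y) ↔
        (dijoin (nJoin fun i : Fin n => D i.castSucc) (D (Fin.last n))).Adj x y := by
  let f : ((i : Fin n) × V i.castSucc) ⊕ V (Fin.last n) → ((i : Fin (n + 1)) × V i) :=
    Sum.elim (fun p => ⟨p.1.castSucc, p.2⟩) (fun v => ⟨Fin.last n, v⟩)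
  have hf : Function.Bijective f := by
    constructor
    · rintro (⟨i, u⟩ | u) (⟨k, v⟩ | v) h
      · simp only [f, Sum.elim_inl, Sigma.mk.injEq, Fin.castSucc_inj] at h
        obtain ⟨rfl, h⟩ := h
        rw [eq_of_heq h]
      · simp only [f, Sum.elim_inl, Sum.elim_inr, Sigma.mk.injEq] at h
        exact absurd h.1 (Fin.castSucc_lt_last i).ne
      · simp only [f, Sum.elim_inl, Sum.elim_inr, Sigma.mk.injEq] at h
        exact absurd h.1.symm (Fin.castSucc_lt_last k).ne
      · simp only [f, Sum.elim_inr, Sigma.mk.injEq] at h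
        rw [eq_of_heq h.2]
    · rintro ⟨i, v⟩
      induction i using Fin.lastCases with
      | last => exact ⟨Sum.inr v, rfl⟩
      | cast i => exact ⟨Sum.inl ⟨i, v⟩, rfl⟩
  refine ⟨Equiv.ofBijective f hf, fun _ _ => rfl, fun _ => rfl, ?_⟩
  rintro (⟨i, u⟩ | u) (⟨k, v⟩ | v)
  · simp only [Equiv.ofBijective_apply, f, Sum.elim_inl, nJoin, dijoin, Sum.lex_inl_inl]
    constructor
    · intro h
      rcases Sigma.lex_iff.1 h with h | ⟨h, h'⟩
      · exact Sigma.Lex.left _ _ (Fin.castSucc_lt_castSucc_iff.1 h)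
      · obtain rfl := Fin.castSucc_injective n h
        exact Sigma.Lex.right _ _ h'
    · rintro (⟨_, _, h⟩ | ⟨_, _, h⟩)
      · exact Sigma.Lex.left _ _ (Fin.castSucc_lt_castSucc_iff.2 h)
      · exact Sigma.Lex.right _ _ h
  · simp [f, nJoin, dijoin, Sigma.lex_iff, Fin.castSucc_lt_last]
  · simp only [Equiv.ofBijective_apply, f, Sum.elim_inl, Sum.elim_inr, nJoin, dijoin,
      Sum.lex_inr_inl, iff_false]
    intro h
    rcases Sigma.lex_iff.1 h with h | ⟨h, _⟩
    · exact lt_asymm h (Fin.castSucc_lt_last k)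
    · exact (Fin.castSucc_lt_last k).ne h.symm
  · simp [f, nJoin, dijoin, Sigma.lex_iff]

end OrientedGraph

/-! A family of sets acts on arcs only through its Gram matrix over 𝔽₂: an arc `u v` ends up
reversed exactly when the entry at `u`, `v` is 1. So `inv` is governed by the symmetric matrices
that record, on arcs, the inversions of some vertex order (`Straightens`), and `minRank` is their
least rank. A symmetric matrix of rank r is a Gram matrix of r vectors if it is zero or has a
nonzero diagonal entry, and of r + 1 vectors in general. Hence `inv` is `minRank` or `minRank + 1`,
and equals `minRank` whenever `inv` is at most 2.

Upper bound: the extra vector is free when some square is already present (`exists_gram_eq_add`).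
With block diagonal matrices, `D j` then costs only `minRank` as soon as another part has positive
`inv`. In the same way `inv (C3 → D j) = minRank (D j) + 1`, so the triangle condition says exactly
that `inv` and `minRank` differ at `D j`.

Lower bound: let all arcs between `S` and `T` go from `S` to `T`. The row of any `s ∈ S`, restricted
to `T`, is the indicator of an initial segment of the order. Schur complements at nonsingular
principal minors of size one or two therefore only reverse or exchange segments of that order: the
result still straightens `T`, and the rank drops by one or two. If no suitable minor of size two
exists, the matrix on `S` has rank at most one on its own. Thus a part of `minRank` at most 2 can be
stripped off at full cost (`exists_straightens_of_forall_adj`), and stripping parts from both ends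
until only `D j` remains makes `minRank` superadditive (`sum_minRank_le_rank`). -/

namespace OrientedGraph

open Matrix

/-! ### Ranks of symmetric matrices over 𝔽₂ -/

section Rank

variable {V : Type*} [Fintype V]

/-- Eliminating a nonzero diagonal entry of a symmetric matrix over `𝔽₂` lowers the rank. -/
theorem rank_add_vecMulVec_self_le {A : Matrix V V (ZMod 2)} (hA : A.IsSymm) {s : V}
    (hs : A s s = 1) : (A + vecMulVec (A s) (A s)).rank + 1 ≤ A.rank := by
  classical
  have hcol : A *ᵥ Pi.single s 1 = A s := by
    ext u
    simp [hA.apply s u]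
  have hx : ∀ x, (A + vecMulVec (A s) (A s)) *ᵥ x = A *ᵥ x + (A s ⬝ᵥ x) • A s := by
    intro x
    rw [add_mulVec, vecMulVec_mulVec]
    simp
  -- The new range lies in the old one but misses `A s`: all its vectors vanish at the coordinate
  -- `s`, where `A s` is 1.
  refine Submodule.finrank_lt_finrank_of_lt (lt_of_le_of_ne ?_ ?_)
  · rintro _ ⟨x, rfl⟩
    rw [mulVecLin_apply, hx]
    exact add_mem ⟨x, rfl⟩ (Submodule.smul_mem _ _ ⟨_, hcol⟩)
  · intro h
    have h1 : A s ∈ LinearMap.range A.mulVecLin := ⟨_, hcol⟩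
    rw [← h] at h1
    obtain ⟨x, hx1⟩ := h1
    rw [mulVecLin_apply, hx] at hx1
    have h2 := congrFun hx1 s
    simp only [Pi.add_apply, Pi.smul_apply, smul_eq_mul, hs, mul_one] at h2
    change A s ⬝ᵥ x + A s ⬝ᵥ x = 1 at h2
    rw [CharTwo.add_self_eq_zero] at h2
    exact zero_ne_one h2

/-- Eliminating a hyperbolic pair of a symmetric matrix over `𝔽₂` lowers the rank by two. -/
theorem rank_add_vecMulVec_add_vecMulVec_le {A : Matrix V V (ZMod 2)} (hA : A.IsSymm) {s t : V}
    (hs : A s s = 0) (ht : A t t = 0) (hst : A s t = 1) :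
    (A + (vecMulVec (A s) (A t) + vecMulVec (A t) (A s))).rank + 2 ≤ A.rank := by
  classical
  have hcol : ∀ r, A *ᵥ Pi.single r 1 = A r := by
    intro r
    ext u
    simp [hA.apply r u]
  have hts : A t s = 1 := by rw [hA.apply, hst]
  have hx : ∀ x, (A + (vecMulVec (A s) (A t) + vecMulVec (A t) (A s))) *ᵥ x =
      A *ᵥ x + ((A t ⬝ᵥ x) • A s + (A s ⬝ᵥ x) • A t) := by
    intro x
    rw [add_mulVec, add_mulVec, vecMulVec_mulVec, vecMulVec_mulVec]
    simp
  set M := LinearMap.range A.mulVecLin with hM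
  have hmem : ∀ r, A r ∈ M := fun r => ⟨_, hcol r⟩
  -- Two strict inclusions: the new range vanishes at both `s` and `t`, whereas `A t` lies in `M`
  -- but not in `N`, and `A s` lies in `N` but does not vanish at `t`.
  let N : Submodule (ZMod 2) (V → ZMod 2) := M ⊓ LinearMap.ker (LinearMap.proj s)
  have h1 : N < M := by
    refine lt_of_le_of_ne inf_le_left fun h => ?_
    have h2 := hmem t
    rw [← h] at h2
    have h3 : A t s = 0 := h2.2
    rw [hts] at h3
    exact one_ne_zero h3
  have h4 : LinearMap.range
      (A + (vecMulVec (A s) (A t) + vecMulVec (A t) (A s))).mulVecLin < N := by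
    refine lt_of_le_of_ne ?_ fun h => ?_
    · rintro _ ⟨x, rfl⟩
      rw [mulVecLin_apply, hx]
      refine ⟨add_mem ⟨x, rfl⟩ (add_mem (Submodule.smul_mem _ _ (hmem s))
        (Submodule.smul_mem _ _ (hmem t))), ?_⟩
      change A s ⬝ᵥ x + (A t ⬝ᵥ x * A s s + A s ⬝ᵥ x * A t s) = 0
      rw [hs, hts, mul_zero, zero_add, mul_one, CharTwo.add_self_eq_zero]
    · have h2 : A s ∈ N := ⟨hmem s, hs⟩
      rw [← h] at h2
      obtain ⟨x, hx1⟩ := h2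
      rw [mulVecLin_apply, hx] at hx1
      have h3 := congrFun hx1 t
      change A t ⬝ᵥ x + (A t ⬝ᵥ x * A s t + A s ⬝ᵥ x * A t t) = A s t at h3
      rw [hst, ht, mul_zero, add_zero, mul_one, CharTwo.add_self_eq_zero] at h3
      exact zero_ne_one h3
  have h5 := Submodule.finrank_lt_finrank_of_lt h1
  have h6 := Submodule.finrank_lt_finrank_of_lt h4
  rw [← Nat.succ_le_iff] at h5 h6
  exact (Nat.succ_le_succ h6).trans h5

theorem rank_conj_le {U W : Type*} [Fintype U] [Fintype W] (P : Matrix U W (ZMod 2))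
    (A : Matrix W W (ZMod 2)) : (P * A * Pᵀ).rank ≤ A.rank :=
  (rank_mul_le_left _ _).trans (rank_mul_le_right _ _)

theorem rank_submatrix_le_rank {U W : Type*} [Fintype U] [Fintype W] (f : W → U)
    (A : Matrix U U (ZMod 2)) : (A.submatrix f f).rank ≤ A.rank := by
  classical
  have h : A.submatrix f f =
      (1 : Matrix U U (ZMod 2)).submatrix f id * A * ((1 : Matrix U U (ZMod 2)).submatrix f id)ᵀ := by
    ext u v
    simp [Matrix.mul_apply, Matrix.one_apply]
  rw [h]
  exact rank_conj_le _ _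

/-- A symmetric matrix extends by zero along an injection without increasing its rank. -/
theorem exists_zero_extension {U W : Type*} [Fintype U] [Fintype W] (f : W → U)
    (hf : Function.Injective f) {A : Matrix W W (ZMod 2)} (hA : A.IsSymm) :
    ∃ B : Matrix U U (ZMod 2), B.IsSymm ∧ B.rank ≤ A.rank ∧ B.submatrix f f = A ∧
      ∀ u v, u ∉ Set.range f → B u v = 0 := by
  classical
  let P : Matrix U W (ZMod 2) := (1 : Matrix U U (ZMod 2)).submatrix id f
  refine ⟨P * A * Pᵀ, ?_, rank_conj_le _ _, ?_, ?_⟩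
  · simp [Matrix.IsSymm, Matrix.mul_assoc, hA.eq]
  · ext u v
    simp [P, Matrix.mul_apply, Matrix.one_apply, hf.eq_iff]
  · intro u v hu
    have h : ∀ w, P u w = 0 := fun w => by
      have : u ≠ f w := fun h => hu ⟨w, h.symm⟩
      simp [P, this]
    simp [Matrix.mul_apply, h]

end Rank

/-! ### Straightening matrices and elimination of vertices -/

/-- On the vertices in `S`, reversing the arcs `u v` with `A u v = 1` turns every arc of `G` into
one along which `σ` increases. -/
def Orders {V : Type*} (G : OrientedGraph V) (S : Set V) (A : Matrix V V (ZMod 2))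
    (σ : V → ℕ) : Prop :=
  ∀ u ∈ S, ∀ v ∈ S, G.Adj u v → σ u ≠ σ v ∧ A u v = if σ v < σ u then 1 else 0

/-- `A` is symmetric and reversing the arcs `u v` with `A u v = 1` makes `G` acyclic on `S`. -/
def Straightens {V : Type*} (G : OrientedGraph V) (S : Set V) (A : Matrix V V (ZMod 2)) : Prop :=
  A.IsSymm ∧ ∃ σ, G.Orders S A σ

section Elimination

variable {V : Type*} {G : OrientedGraph V} {S T : Set V} {A : Matrix V V (ZMod 2)}

theorem Orders.mono {σ : V → ℕ} (h : G.Orders T A σ) (hST : S ⊆ T) : G.Orders S A σ :=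
  fun u hu v hv => h u (hST hu) v (hST hv)

theorem Straightens.mono (h : G.Straightens T A) (hST : S ⊆ T) : G.Straightens S A :=
  ⟨h.1, h.2.imp fun _ h => h.mono hST⟩

theorem isSymm_vecMulVec_self (f : V → ZMod 2) : (vecMulVec f f).IsSymm := by
  ext u v
  simp [vecMulVec_apply, mul_comm]

/-- The entries of `A` in the row `s` mark the vertices of `T` that `σ` puts before `s`. -/
def MarksBefore (A : Matrix V V (ZMod 2)) (σ : V → ℕ) (T : Set V) (s : V) : Prop :=
  ∀ e ∈ T, σ e ≠ σ s ∧ A s e = if σ e < σ s then 1 else 0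

/-- The added square toggles the pairs lying inside the initial segment before `s`, which is what
reversing that segment does to the order. -/
theorem Straightens.add_vecMulVec_self {σ : V → ℕ} (hA : A.IsSymm) (hσ : G.Orders T A σ) {s : V}
    (hs : MarksBefore A σ T s) : G.Straightens T (A + vecMulVec (A s) (A s)) := by
  refine ⟨hA.add (isSymm_vecMulVec_self _),
    fun e => if σ e < σ s then σ s - σ e else σ e, fun u hu v hv huv => ?_⟩
  obtain ⟨h0, h1⟩ := hσ u hu v hv huv
  obtain ⟨h2, h3⟩ := hs u hu
  obtain ⟨h4, h5⟩ := hs v hv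
  rw [Matrix.add_apply, vecMulVec_apply, h1, h3, h5]
  dsimp only
  constructor <;> split_ifs <;> first | rfl | omega

/-- The toggled pairs have one vertex before `s` and the other between `s` and `t`, so exchanging
these two consecutive blocks gives the new order. -/
theorem Straightens.add_hyperbolic {σ : V → ℕ} (hA : A.IsSymm) (hσ : G.Orders T A σ) {s t : V}
    (hs : MarksBefore A σ T s) (ht : MarksBefore A σ T t) (hst : σ s ≤ σ t) :
    G.Straightens T (A + (vecMulVec (A s) (A t) + vecMulVec (A t) (A s))) := by
  refine ⟨hA.add ?_, fun e => if σ e < σ s then σ e + (σ t - σ s) else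
    if σ e < σ t then σ e - σ s else σ e, fun u hu v hv huv => ?_⟩
  · ext u v
    simp [vecMulVec_apply, mul_comm, add_comm]
  obtain ⟨h0, h1⟩ := hσ u hu v hv huv
  obtain ⟨h2, h3⟩ := hs u hu
  obtain ⟨h4, h5⟩ := hs v hv
  obtain ⟨h6, h7⟩ := ht u hu
  obtain ⟨h8, h9⟩ := ht v hv
  rw [Matrix.add_apply, Matrix.add_apply, vecMulVec_apply, vecMulVec_apply, h1, h3, h5, h7, h9]
  dsimp only
  constructor <;> split_ifs <;> first | rfl | omega

theorem zmod_two_cases (x : ZMod 2) : x = 0 ∨ x = 1 := by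
  revert x
  decide

/-- Both initial segments get reversed. The shorter one is toggled twice, so it keeps its internal
order and trades places with the rest of the longer one, which is reversed. -/
theorem Orders.exists_add_add_of_eq_zero {σ : V → ℕ} (hσ : G.Orders T A σ) {s t : V}
    (hs : MarksBefore A σ T s) (ht : MarksBefore A σ T t) (hst : A s t = 0) :
    ∃ τ, G.Orders T (A + vecMulVec (A s) (A s) +
      vecMulVec (A t + A s t • A s) (A t + A s t • A s)) τ := by
  have key : ∀ u ∈ T, ∀ v ∈ T, G.Adj u v → (A + vecMulVec (A s) (A s) +
      vecMulVec (A t + A s t • A s) (A t + A s t • A s)) u v =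
        (if σ v < σ u then 1 else 0) + (if σ u < σ s then 1 else 0) * (if σ v < σ s then 1 else 0) +
        (if σ u < σ t then 1 else 0) * (if σ v < σ t then 1 else 0) := by
    intro u hu v hv huv
    simp only [Matrix.add_apply, vecMulVec_apply, Pi.add_apply, Pi.smul_apply, smul_eq_mul, hst,
      (hσ u hu v hv huv).2, (hs u hu).2, (hs v hv).2, (ht u hu).2, (ht v hv).2, zero_mul, add_zero]
  obtain h | h := le_or_gt (σ s) (σ t)
  · refine ⟨fun e => if σ e < σ s then σ e + (σ t - σ s) else
      if σ e < σ t then σ t - σ e else σ e, fun u hu v hv huv => ?_⟩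
    have h0 := (hσ u hu v hv huv).1
    have h1 := (hs u hu).1
    have h2 := (hs v hv).1
    have h3 := (ht u hu).1
    have h4 := (ht v hv).1
    rw [key u hu v hv huv]
    dsimp only
    constructor <;> split_ifs <;> first | rfl | omega
  · refine ⟨fun e => if σ e < σ t then σ e + (σ s - σ t) else
      if σ e < σ s then σ s - σ e else σ e, fun u hu v hv huv => ?_⟩
    have h0 := (hσ u hu v hv huv).1
    have h1 := (hs u hu).1
    have h2 := (hs v hv).1
    have h3 := (ht u hu).1
    have h4 := (ht v hv).1
    rw [key u hu v hv huv]
    dsimp only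
    constructor <;> split_ifs <;> first | rfl | omega

/-- Here the second square toggles the block between `s` and `t`. If `s` comes first, the two blocks
are reversed in place; otherwise the middle block, toggled twice, moves to the front unchanged and
the block before `t` is reversed behind it. -/
theorem Orders.exists_add_add_of_eq_one {σ : V → ℕ} (hσ : G.Orders T A σ) {s t : V}
    (hs : MarksBefore A σ T s) (ht : MarksBefore A σ T t) (hst : A s t = 1) :
    ∃ τ, G.Orders T (A + vecMulVec (A s) (A s) +
      vecMulVec (A t + A s t • A s) (A t + A s t • A s)) τ := by
  have key : ∀ u ∈ T, ∀ v ∈ T, G.Adj u v → (A + vecMulVec (A s) (A s) +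
      vecMulVec (A t + A s t • A s) (A t + A s t • A s)) u v =
        (if σ v < σ u then 1 else 0) + (if σ u < σ s then 1 else 0) * (if σ v < σ s then 1 else 0) +
        ((if σ u < σ t then 1 else 0) + (if σ u < σ s then 1 else 0)) *
          ((if σ v < σ t then 1 else 0) + (if σ v < σ s then 1 else 0)) := by
    intro u hu v hv huv
    simp only [Matrix.add_apply, vecMulVec_apply, Pi.add_apply, Pi.smul_apply, smul_eq_mul, hst,
      (hσ u hu v hv huv).2, (hs u hu).2, (hs v hv).2, (ht u hu).2, (ht v hv).2, one_mul]
  obtain h | h := le_or_gt (σ s) (σ t)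
  · refine ⟨fun e => if σ e < σ s then σ s - σ e else
      if σ e < σ t then σ s + σ t - σ e else σ e, fun u hu v hv huv => ?_⟩
    have h0 := (hσ u hu v hv huv).1
    have h1 := (hs u hu).1
    have h2 := (hs v hv).1
    have h3 := (ht u hu).1
    have h4 := (ht v hv).1
    rw [key u hu v hv huv]
    dsimp only
    constructor <;> split_ifs <;> first | rfl | omega
  · refine ⟨fun e => if σ e < σ t then σ s - σ e else
      if σ e < σ s then σ e - σ t else σ e, fun u hu v hv huv => ?_⟩
    have h0 := (hσ u hu v hv huv).1
    have h1 := (hs u hu).1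
    have h2 := (hs v hv).1
    have h3 := (ht u hu).1
    have h4 := (ht v hv).1
    rw [key u hu v hv huv]
    dsimp only
    constructor <;> split_ifs <;> first | rfl | omega

/-- Two successive eliminations of vertices `s` and `t`. -/
theorem Straightens.add_add {σ : V → ℕ} (hA : A.IsSymm) (hσ : G.Orders T A σ) {s t : V}
    (hs : MarksBefore A σ T s) (ht : MarksBefore A σ T t) :
    G.Straightens T (A + vecMulVec (A s) (A s) +
      vecMulVec (A t + A s t • A s) (A t + A s t • A s)) :=
  ⟨(hA.add (isSymm_vecMulVec_self _)).add (isSymm_vecMulVec_self _),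
    (zmod_two_cases (A s t)).elim (hσ.exists_add_add_of_eq_zero hs ht)
      (hσ.exists_add_add_of_eq_one hs ht)⟩

variable [Fintype V]

/-- A nonsingular principal `2 × 2` minor can be eliminated. -/
theorem exists_straightens_of_minor {σ : V → ℕ} (hA : A.IsSymm) (hσ : G.Orders T A σ) {s t : V}
    (hs : MarksBefore A σ T s) (ht : MarksBefore A σ T t) (hst : A s t ≠ A s s * A t t) :
    ∃ B, G.Straightens T B ∧ B.rank + 2 ≤ A.rank := by
  have main : ∀ s t, MarksBefore A σ T s → MarksBefore A σ T t → A s t ≠ A s s * A t t →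
      A s s = 1 → ∃ B, G.Straightens T B ∧ B.rank + 2 ≤ A.rank := by
    intro s t hs ht hst h
    refine ⟨_, Straightens.add_add hA hσ hs ht, ?_⟩
    set A' := A + vecMulVec (A s) (A s) with hA'
    have e : A' t = A t + A s t • A s := by
      ext u
      simp [hA', vecMulVec_apply]
    -- After eliminating `s`, the diagonal entry at `t` is the determinant of the minor.
    have e2 : A' t t = 1 := by
      rw [e]
      simp only [Pi.add_apply, Pi.smul_apply, smul_eq_mul]
      rw [h, one_mul] at hst
      obtain h1 | h1 := zmod_two_cases (A s t) <;> obtain h2 | h2 := zmod_two_cases (A t t) <;>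
        simp_all
    have h1 := rank_add_vecMulVec_self_le (hA.add (isSymm_vecMulVec_self (A s))) e2
    have h2 := rank_add_vecMulVec_self_le hA h
    rw [← hA', e] at h1
    rw [← hA'] at h2
    omega
  obtain h1 | h1 := zmod_two_cases (A s s)
  · obtain h2 | h2 := zmod_two_cases (A t t)
    · have h3 : A s t = 1 := (zmod_two_cases _).resolve_left (by simpa [h1] using hst)
      obtain h | h := le_total (σ s) (σ t)
      · exact ⟨_, Straightens.add_hyperbolic hA hσ hs ht h,
          rank_add_vecMulVec_add_vecMulVec_le hA h1 h2 h3⟩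
      · exact ⟨_, Straightens.add_hyperbolic hA hσ ht hs h,
          rank_add_vecMulVec_add_vecMulVec_le hA h2 h1 (by rw [hA.apply, h3])⟩
    · exact main t s ht hs (by rwa [hA.apply, mul_comm]) h2
  · exact main s t hs ht hst h1

/-- A nonsingular minor of size two inside `S` pays for any `ρ ≤ 2`. Without one, `A` on `S` is the
square of its diagonal, which forces `ρ ≤ 1`, or `ρ = 0` if that diagonal vanishes; a single
elimination, or none, is then enough. -/
theorem exists_straightens_of_forall_adj (hST : ∀ s ∈ S, ∀ t ∈ T, G.Adj s t)
    (hA : G.Straightens (S ∪ T) A) {ρ : ℕ} (hρ : ρ ≤ 2)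
    (hS : ∀ B, G.Straightens S B → ρ ≤ B.rank) :
    ∃ B, G.Straightens T B ∧ B.rank + ρ ≤ A.rank := by
  obtain ⟨hsymm, σ, hσ⟩ := hA
  have hT : G.Orders T A σ := hσ.mono Set.subset_union_right
  have hm : ∀ s ∈ S, MarksBefore A σ T s := fun s hs e he =>
    have h := hσ s (Or.inl hs) e (Or.inr he) (hST s hs e he)
    ⟨h.1.symm, h.2⟩
  by_cases h2 : ∃ s ∈ S, ∃ t ∈ S, A s t ≠ A s s * A t t
  · obtain ⟨s, hs, t, ht, hst⟩ := h2
    obtain ⟨B, hB, hB'⟩ := exists_straightens_of_minor hsymm hT (hm s hs) (hm t ht) hst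
    exact ⟨B, hB, by omega⟩
  push Not at h2
  by_cases h1 : ∃ s ∈ S, A s s = 1
  · obtain ⟨s, hs, hss⟩ := h1
    refine ⟨_, Straightens.add_vecMulVec_self hsymm hT (hm s hs), ?_⟩
    have h3 := rank_add_vecMulVec_self_le hsymm hss
    have h4 := hS (vecMulVec (fun v => A v v) (fun v => A v v))
      ⟨isSymm_vecMulVec_self _, σ, fun u hu v hv huv => by
        rw [vecMulVec_apply, ← h2 u hu v hv]
        exact hσ u (Or.inl hu) v (Or.inl hv) huv⟩
    have h5 := rank_vecMulVec_le (fun v => A v v) (fun v => A v v)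
    omega
  · push Not at h1
    have h0 : ∀ s ∈ S, A s s = 0 := fun s hs => (zmod_two_cases _).resolve_right (h1 s hs)
    have h4 := hS 0 ⟨isSymm_zero, σ, fun u hu v hv huv => by
        have h := hσ u (Or.inl hu) v (Or.inl hv) huv
        rw [h2 u hu v hv, h0 u hu, zero_mul] at h
        exact h⟩
    rw [rank_zero] at h4
    exact ⟨A, ⟨hsymm, σ, hT⟩, by omega⟩

/-- The graph with all arcs reversed. -/
def op {V : Type*} (G : OrientedGraph V) : OrientedGraph V where
  Adj u v := G.Adj v u
  asymm u v := G.asymm v u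

theorem straightens_op_iff : G.op.Straightens S A ↔ G.Straightens S A := by
  have main : ∀ G : OrientedGraph V, G.Straightens S A → G.op.Straightens S A := by
    rintro G ⟨hA, σ, hσ⟩
    refine ⟨hA, fun v => (∑ w, σ w) - σ v, fun u hu v hv huv => ?_⟩
    obtain ⟨h1, h2⟩ := hσ v hv u hu huv
    have hu := Finset.single_le_sum (f := σ) (fun _ _ => Nat.zero_le _) (Finset.mem_univ u)
    have hv := Finset.single_le_sum (f := σ) (fun _ _ => Nat.zero_le _) (Finset.mem_univ v)
    rw [hA.apply, h2]
    dsimp only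
    constructor
    · omega
    · split_ifs <;> first | rfl | omega
  exact ⟨main G.op, main G⟩

theorem exists_straightens_of_forall_adj_or
    (hST : (∀ s ∈ S, ∀ t ∈ T, G.Adj s t) ∨ (∀ s ∈ S, ∀ t ∈ T, G.Adj t s))
    (hA : G.Straightens (S ∪ T) A) {ρ : ℕ} (hρ : ρ ≤ 2)
    (hS : ∀ B, G.Straightens S B → ρ ≤ B.rank) :
    ∃ B, G.Straightens T B ∧ B.rank + ρ ≤ A.rank := by
  obtain h | h := hST
  · exact exists_straightens_of_forall_adj h hA hρ hS
  · obtain ⟨B, hB, h'⟩ := exists_straightens_of_forall_adj (G := G.op) h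
      (straightens_op_iff.2 hA) hρ fun B hB => hS B (straightens_op_iff.1 hB)
    exact ⟨B, straightens_op_iff.1 hB, h'⟩

end Elimination

/-! ### Gram matrices of families of sets -/

section Families

variable {V : Type*}

/-- The Gram matrix over `𝔽₂` of the incidence vectors given by a family of sets: its entry at
`u`, `v` is the parity of the number of members containing both `u` and `v`. -/
noncomputable def gram : List (Set V) → Matrix V V (ZMod 2)
  | [] => 0
  | X :: F => vecMulVec (X.indicator 1) (X.indicator 1) + gram F

theorem gram_append (F F' : List (Set V)) : gram (F ++ F') = gram F + gram F' := by
  induction F with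
  | nil => simp [gram]
  | cons X F ih => rw [List.cons_append, gram, gram, ih, add_assoc]

theorem gram_isSymm (F : List (Set V)) : (gram F).IsSymm := by
  induction F with
  | nil => exact isSymm_zero
  | cons X F ih => exact (isSymm_vecMulVec_self _).add ih

theorem gram_map_preimage {W : Type*} (f : W → V) (F : List (Set V)) :
    gram (F.map (f ⁻¹' ·)) = (gram F).submatrix f f := by
  induction F with
  | nil => rfl
  | cons X F ih =>
    rw [List.map_cons, gram, gram, ih]
    rfl

theorem gram_map_image_apply {W : Type*} {f : W → V} (hf : Function.Injective f)
    (F : List (Set W)) : (gram (F.map (f '' ·))).submatrix f f = gram F := by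
  rw [← gram_map_preimage, List.map_map]
  conv_rhs => rw [← List.map_id F]
  congr 1
  exact List.map_congr_left fun X _ => hf.preimage_image X

theorem gram_map_image_eq_zero {W : Type*} (f : W → V) (F : List (Set W)) {u : V}
    (hu : u ∉ Set.range f) (v : V) : gram (F.map (f '' ·)) u v = 0 := by
  induction F with
  | nil => rfl
  | cons X F ih =>
    have h : u ∉ f '' X := fun h => hu (Set.image_subset_range _ _ h)
    rw [List.map_cons, gram, Matrix.add_apply, vecMulVec_apply, ih, Set.indicator_of_notMem h,
      zero_mul, add_zero]

theorem rank_add_le_rank_add_rank [Fintype V] (A B : Matrix V V (ZMod 2)) :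
    (A + B).rank ≤ A.rank + B.rank := by
  refine (Submodule.finrank_mono ?_).trans (Submodule.finrank_add_le_finrank_add_finrank
    (LinearMap.range A.mulVecLin) (LinearMap.range B.mulVecLin))
  rintro _ ⟨x, rfl⟩
  rw [mulVecLin_add]
  exact Submodule.add_mem_sup ⟨x, rfl⟩ ⟨x, rfl⟩

theorem eq_zero_of_rank_eq_zero [Fintype V] {A : Matrix V V (ZMod 2)} (h : A.rank = 0) :
    A = 0 := by
  classical
  have h1 : A.mulVecLin = 0 := LinearMap.range_eq_bot.1 (Submodule.finrank_eq_zero.1 h)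
  ext u v
  simpa using congrFun (LinearMap.congr_fun h1 (Pi.single v 1)) u

theorem gram_rank_le [Fintype V] (F : List (Set V)) : (gram F).rank ≤ F.length := by
  induction F with
  | nil => simp [gram]
  | cons X F ih =>
    have h1 := rank_vecMulVec_le (X.indicator (1 : V → ZMod 2)) (X.indicator 1)
    have h2 := rank_add_le_rank_add_rank (vecMulVec (X.indicator (1 : V → ZMod 2)) (X.indicator 1)) (gram F)
    rw [gram, List.length_cons]
    omega

theorem exists_gram_cons_eq (f : V → ZMod 2) :
    ∃ X : Set V, ∀ F, gram (X :: F) = vecMulVec f f + gram F := by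
  have h : ({v | f v = 1} : Set V).indicator 1 = f := by
    ext v
    obtain h | h := zmod_two_cases (f v) <;> simp [Set.indicator, h]
  exact ⟨{v | f v = 1}, fun F => by rw [gram, h]⟩

/-- Over 𝔽₂ a hyperbolic form is not a sum of two squares, but together with one more square it
becomes a sum of three. -/
theorem vecMulVec_add_hyperbolic (f g h : V → ZMod 2) :
    vecMulVec f f + (vecMulVec g h + vecMulVec h g) =
      vecMulVec (f + g) (f + g) + (vecMulVec (f + h) (f + h) +
        vecMulVec (f + g + h) (f + g + h)) := by
  ext u v
  simp only [Matrix.add_apply, vecMulVec_apply, Pi.add_apply]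
  generalize f u = a, f v = b, g u = c, g v = d, h u = e, h v = k
  revert a b c d e k
  decide

theorem add_add_self_eq (A B : Matrix V V (ZMod 2)) : A + B + B = A := by
  ext u v
  rw [Matrix.add_apply, Matrix.add_apply, add_assoc, CharTwo.add_self_eq_zero, add_zero]

/-- A symmetric matrix over `𝔽₂` plus a rank one square is a Gram matrix of rank many vectors plus
one. -/
theorem exists_gram_eq_add [Fintype V] (A : Matrix V V (ZMod 2)) (hA : A.IsSymm)
    (f : V → ZMod 2) :
    ∃ F : List (Set V), F.length ≤ A.rank + 1 ∧ gram F = A + vecMulVec f f := by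
  induction hr : A.rank using Nat.strong_induction_on generalizing A f with
  | _ r ih =>
    subst hr
    by_cases h1 : ∃ s, A s s = 1
    · obtain ⟨s, hs⟩ := h1
      have h2 := rank_add_vecMulVec_self_le hA hs
      -- The eliminated square takes over the role of `f`, so `f` itself is the one extra vector.
      obtain ⟨F, hF, hF'⟩ := ih _ (by omega) _ (hA.add (isSymm_vecMulVec_self (A s))) (A s) rfl
      obtain ⟨X, hX⟩ := exists_gram_cons_eq f
      refine ⟨X :: F, ?_, ?_⟩
      · rw [List.length_cons]
        omega
      · rw [hX, hF', add_add_self_eq, add_comm]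
    push Not at h1
    have h0 : ∀ s, A s s = 0 := fun s => (zmod_two_cases _).resolve_right (h1 s)
    by_cases h2 : ∃ s t, A s t = 1
    · obtain ⟨s, t, hst⟩ := h2
      have h3 := rank_add_vecMulVec_add_vecMulVec_le hA (h0 s) (h0 t) hst
      have h4 : (vecMulVec (A s) (A t) + vecMulVec (A t) (A s)).IsSymm := by
        ext u v
        simp [vecMulVec_apply, mul_comm, add_comm]
      -- Of the three squares replacing `f` and the hyperbolic pair, one is passed to the induction
      -- and two become sets, matching the rank drop of two.
      obtain ⟨F, hF, hF'⟩ := ih _ (by omega) _ (hA.add h4) (f + A s + A t) rfl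
      obtain ⟨X, hX⟩ := exists_gram_cons_eq (f + A s)
      obtain ⟨Y, hY⟩ := exists_gram_cons_eq (f + A t)
      refine ⟨X :: Y :: F, ?_, ?_⟩
      · rw [List.length_cons, List.length_cons]
        omega
      · have h5 := vecMulVec_add_hyperbolic f (A s) (A t)
        have h6 := add_add_self_eq (vecMulVec f f) (vecMulVec (A s) (A t) + vecMulVec (A t) (A s))
        rw [h5] at h6
        rw [hX, hY, hF', ← h6]
        abel
    · push Not at h2
      have h3 : A = 0 := by
        ext s t
        exact (zmod_two_cases _).resolve_right (h2 s t)
      obtain ⟨X, hX⟩ := exists_gram_cons_eq f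
      refine ⟨[X], by simp, ?_⟩
      rw [hX, h3, gram, add_comm]

theorem adj_invertFamily_iff (G : OrientedGraph V) (F : List (Set V)) (u v : V) :
    (G.invertFamily F).Adj u v ↔
      (gram F u v = 0 ∧ G.Adj u v) ∨ (gram F u v = 1 ∧ G.Adj v u) := by
  induction F generalizing G with
  | nil => simp [invertFamily, gram]
  | cons X F ih =>
    change ((G.invert X).invertFamily F).Adj u v ↔ _
    rw [ih, gram, Matrix.add_apply, vecMulVec_apply]
    have h11 : (1 : ZMod 2) + 1 = 0 := rfl
    by_cases hu : u ∈ X <;> by_cases hv : v ∈ X <;>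
      obtain h | h := zmod_two_cases (gram F u v) <;> simp [invert, hu, hv, h, h11]

theorem isDecyclingFamily_iff [Finite V] (G : OrientedGraph V) (F : List (Set V)) :
    G.IsDecyclingFamily F ↔ G.Straightens Set.univ (gram F) := by
  constructor
  · intro h
    let R := (G.invertFamily F).Adj
    have hR : ∀ u v, R u v →
        {w | Relation.TransGen R w u}.ncard < {w | Relation.TransGen R w v}.ncard := by
      intro u v huv
      refine Set.ncard_lt_ncard ⟨fun w hw => Relation.TransGen.tail hw huv, fun hs => ?_⟩
        (Set.toFinite _)
      exact h u (hs (Relation.TransGen.single huv))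
    -- In an acyclic graph the number of proper ancestors strictly increases along arcs.
    refine ⟨gram_isSymm F, fun v => {w | Relation.TransGen R w v}.ncard, ?_⟩
    intro u _ v _ huv
    obtain h0 | h0 := zmod_two_cases (gram F u v)
    · have h1 := hR u v ((adj_invertFamily_iff G F u v).2 (Or.inl ⟨h0, huv⟩))
      exact ⟨h1.ne, by rw [h0, if_neg h1.not_gt]⟩
    · have h1 := hR v u ((adj_invertFamily_iff G F v u).2
        (Or.inr ⟨by rw [(gram_isSymm F).apply, h0], huv⟩))
      exact ⟨h1.ne', by rw [h0, if_pos h1]⟩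
  · rintro ⟨-, σ, hσ⟩
    have hR : ∀ u v, (G.invertFamily F).Adj u v → σ u < σ v := by
      intro u v huv
      obtain ⟨h0, h1⟩ | ⟨h0, h1⟩ := (adj_invertFamily_iff G F u v).1 huv
      · obtain ⟨h2, h3⟩ := hσ u trivial v trivial h1
        rw [h0] at h3
        by_contra h4
        rw [if_pos (by omega)] at h3
        exact zero_ne_one h3
      · obtain ⟨h2, h3⟩ := hσ v trivial u trivial h1
        rw [(gram_isSymm F).apply, h0] at h3
        by_contra h4
        rw [if_neg h4] at h3
        exact one_ne_zero h3
    intro v hv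
    have key : ∀ w, Relation.TransGen (G.invertFamily F).Adj v w → σ v < σ w := by
      intro w h
      induction h with
      | single h => exact hR _ _ h
      | tail _ h ih => exact ih.trans (hR _ _ h)
    exact lt_irrefl _ (key v hv)

theorem exists_gram_straightens [Finite V] (G : OrientedGraph V) :
    ∃ F : List (Set V), F.length = G.inv ∧ G.Straightens Set.univ (gram F) := by
  obtain ⟨F, hF⟩ := G.exists_isDecyclingFamily
  obtain ⟨F', h, h'⟩ := Nat.sInf_mem
    (s := {m : ℕ | ∃ F : List (Set V), F.length = m ∧ G.IsDecyclingFamily F}) ⟨_, F, rfl, hF⟩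
  exact ⟨F', h, (isDecyclingFamily_iff G F').1 h'⟩

theorem inv_le_length [Finite V] {G : OrientedGraph V} {F : List (Set V)}
    (h : G.Straightens Set.univ (gram F)) : G.inv ≤ F.length :=
  Nat.sInf_le ⟨F, rfl, (isDecyclingFamily_iff G F).2 h⟩

theorem Straightens.submatrix {W : Type*} {G : OrientedGraph V} {H : OrientedGraph W} {S : Set V}
    {A : Matrix V V (ZMod 2)} (hA : G.Straightens S A) {f : W → V} (hf : ∀ w, f w ∈ S)
    (hadj : ∀ u v, H.Adj u v → G.Adj (f u) (f v)) :
    H.Straightens Set.univ (A.submatrix f f) := by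
  obtain ⟨h, σ, hσ⟩ := hA
  exact ⟨h.submatrix f, σ ∘ f, fun u _ v _ huv => hσ _ (hf u) _ (hf v) (hadj u v huv)⟩

theorem inv_le_of_map [Finite V] {W : Type*} [Finite W] {G : OrientedGraph V}
    {H : OrientedGraph W} (f : W → V) (hadj : ∀ u v, H.Adj u v → G.Adj (f u) (f v)) :
    H.inv ≤ G.inv := by
  obtain ⟨F, hF, hF'⟩ := G.exists_gram_straightens
  have h := hF'.submatrix (f := f) (fun _ => trivial) hadj
  rw [← gram_map_preimage] at h
  simpa [hF] using inv_le_length h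

/-! ### Minimum rank versus inversion number -/

variable [Fintype V]

/-- One member of `F` serves as the extra square, so `A` costs no more than its rank even if its
diagonal is zero. -/
theorem inv_le_rank_add_length {G : OrientedGraph V} {A : Matrix V V (ZMod 2)} (hA : A.IsSymm)
    {F : List (Set V)} (hF : F ≠ []) (h : G.Straightens Set.univ (A + gram F)) :
    G.inv ≤ A.rank + F.length := by
  obtain _ | ⟨X, F⟩ := F
  · exact absurd rfl hF
  obtain ⟨F', h1, h2⟩ := exists_gram_eq_add A hA (X.indicator 1)
  rw [gram, ← add_assoc, ← h2, ← gram_append] at h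
  have h3 := inv_le_length h
  rw [List.length_append] at h3
  rw [List.length_cons]
  omega

/-- The least rank of a symmetric matrix over `𝔽₂` that straightens `G`. -/
noncomputable def minRank (G : OrientedGraph V) : ℕ :=
  sInf {k : ℕ | ∃ A, G.Straightens Set.univ A ∧ A.rank = k}

theorem exists_straightens_rank_eq (G : OrientedGraph V) :
    ∃ A, G.Straightens Set.univ A ∧ A.rank = G.minRank := by
  obtain ⟨F, -, hF⟩ := G.exists_gram_straightens
  exact Nat.sInf_mem (s := {k : ℕ | ∃ A, G.Straightens Set.univ A ∧ A.rank = k}) ⟨_, _, hF, rfl⟩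

theorem Straightens.minRank_le {G : OrientedGraph V} {A : Matrix V V (ZMod 2)}
    (h : G.Straightens Set.univ A) : G.minRank ≤ A.rank :=
  Nat.sInf_le ⟨A, h, rfl⟩

theorem Straightens.minRank_le_of_map {W : Type*} [Fintype W] {G : OrientedGraph V}
    {H : OrientedGraph W} {S : Set V} {A : Matrix V V (ZMod 2)} (hA : G.Straightens S A)
    {f : W → V} (hf : ∀ w, f w ∈ S) (hadj : ∀ u v, H.Adj u v → G.Adj (f u) (f v)) :
    H.minRank ≤ A.rank :=
  (hA.submatrix hf hadj).minRank_le.trans (rank_submatrix_le_rank f A)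

theorem minRank_le_inv (G : OrientedGraph V) : G.minRank ≤ G.inv := by
  obtain ⟨F, hF, h⟩ := G.exists_gram_straightens
  exact hF ▸ h.minRank_le.trans (gram_rank_le F)

theorem inv_le_minRank_add_one (G : OrientedGraph V) : G.inv ≤ G.minRank + 1 := by
  obtain ⟨A, hA, hr⟩ := G.exists_straightens_rank_eq
  obtain ⟨F, hF, h⟩ := exists_gram_eq_add A hA.1 0
  have h0 : gram F = A := by simpa using h
  exact hr ▸ (inv_le_length (h0 ▸ hA)).trans hF

/-- Rank and Gram length can differ only for a nonzero matrix with zero diagonal, and such a matrix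
already has rank at least 2. -/
theorem minRank_eq_inv {G : OrientedGraph V} (hG : G.inv ≤ 2) : G.minRank = G.inv := by
  refine le_antisymm G.minRank_le_inv ?_
  obtain ⟨A, hA, hr⟩ := G.exists_straightens_rank_eq
  rw [← hr]
  by_cases h1 : ∃ s, A s s = 1
  · obtain ⟨s, hs⟩ := h1
    obtain ⟨F, hF, h⟩ := exists_gram_eq_add _ (hA.1.add (isSymm_vecMulVec_self (A s))) (A s)
    rw [add_add_self_eq] at h
    exact (inv_le_length (h ▸ hA)).trans (hF.trans (rank_add_vecMulVec_self_le hA.1 hs))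
  push Not at h1
  have h0 : ∀ s, A s s = 0 := fun s => (zmod_two_cases _).resolve_right (h1 s)
  by_cases h2 : ∃ s t, A s t = 1
  · obtain ⟨s, t, hst⟩ := h2
    have h3 := rank_add_vecMulVec_add_vecMulVec_le hA.1 (h0 s) (h0 t) hst
    omega
  · push Not at h2
    have h3 : gram [] = A := by
      ext s t
      exact ((zmod_two_cases _).resolve_right (h2 s t)).symm
    exact (inv_le_length (h3 ▸ hA)).trans (Nat.zero_le _)

end Families

/-! ### Bounds for joins -/

section Join

variable {n : ℕ} {V : Fin n → Type*} [∀ i, Fintype (V i)] {D : (i : Fin n) → OrientedGraph (V i)}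

/-- A block diagonal matrix straightens an `n`-join as soon as its blocks straighten the parts. -/
theorem straightens_nJoin {A : Matrix ((i : Fin n) × V i) ((i : Fin n) × V i) (ZMod 2)}
    (hA : A.IsSymm) (hoff : ∀ u v, u.1 ≠ v.1 → A u v = 0)
    (hdiag : ∀ i, (D i).Straightens Set.univ (A.submatrix (Sigma.mk i) (Sigma.mk i))) :
    (nJoin D).Straightens Set.univ A := by
  choose σ hσ using fun i => (hdiag i).2
  let M := (∑ u : (i : Fin n) × V i, σ u.1 u.2) + 1
  have hM : ∀ i v, σ i v < M := fun i v => Nat.lt_succ_of_le <|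
    Finset.single_le_sum (f := fun u : (i : Fin n) × V i => σ u.1 u.2)
      (fun _ _ => Nat.zero_le _) (Finset.mem_univ ⟨i, v⟩)
  refine ⟨hA, fun u => u.1 * M + σ u.1 u.2, ?_⟩
  rintro ⟨i, u⟩ - ⟨k, v⟩ - huv
  rcases Sigma.lex_iff.1 huv with h | ⟨h, h'⟩
  · have h1 : (i : ℕ) * M + M ≤ k * M := by
      rw [← Nat.succ_mul]
      exact Nat.mul_le_mul_right _ h
    have h2 := hM i u
    have h3 := hM k v
    rw [hoff _ _ h.ne]
    dsimp only
    rw [if_neg (by omega)]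
    exact ⟨by omega, rfl⟩
  · dsimp only at h
    subst h
    obtain ⟨h1, h2⟩ := hσ i u trivial v trivial h'
    refine ⟨by simpa using h1, ?_⟩
    dsimp only
    simpa using h2

/-- The minimum rank of an `n`-join is at least the sum of those of its parts, provided that at
most one of them exceeds two. -/
theorem sum_minRank_le_rank {j : Fin n} (h2 : ∀ i, i ≠ j → (D i).minRank ≤ 2) (s : Finset (Fin n))
    (hj : j ∈ s) {A : Matrix ((i : Fin n) × V i) ((i : Fin n) × V i) (ZMod 2)}
    (hA : (nJoin D).Straightens {u | u.1 ∈ s} A) : ∑ i ∈ s, (D i).minRank ≤ A.rank := by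
  induction hc : s.card generalizing s A with
  | zero => simp_all
  | succ c ih =>
    by_cases hs : s = {j}
    · subst hs
      rw [Finset.sum_singleton]
      exact hA.minRank_le_of_map (f := Sigma.mk j) (by simp)
        fun u v huv => Sigma.Lex.right _ _ huv
    -- An extreme index is needed so that all arcs between its part and the others point the same
    -- way; as `s ≠ {j}`, the minimum and the maximum are not both `j`.
    have hex : ∃ i ∈ s, i ≠ j ∧ ((∀ k ∈ s.erase i, i < k) ∨ ∀ k ∈ s.erase i, k < i) := by
      have hne : s.Nonempty := ⟨j, hj⟩
      by_cases hmin : s.min' hne = j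
      · refine ⟨s.max' hne, s.max'_mem hne, fun hmax => hs ?_, Or.inr fun k hk =>
          lt_of_le_of_ne (s.le_max' _ (Finset.mem_of_mem_erase hk)) (Finset.ne_of_mem_erase hk)⟩
        refine Finset.eq_singleton_iff_unique_mem.2 ⟨hj, fun k hk => le_antisymm ?_ ?_⟩
        · exact hmax ▸ s.le_max' _ hk
        · exact hmin ▸ s.min'_le _ hk
      · exact ⟨s.min' hne, s.min'_mem hne, hmin, Or.inl fun k hk =>
          lt_of_le_of_ne (s.min'_le _ (Finset.mem_of_mem_erase hk)) (Finset.ne_of_mem_erase hk).symm⟩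
    obtain ⟨i, hi, hij, hik⟩ := hex
    obtain ⟨B, hB, hBA⟩ := exists_straightens_of_forall_adj_or (G := nJoin D)
      (S := {u | u.1 = i}) (T := {u | u.1 ∈ s.erase i}) (A := A)
      (by
        refine hik.imp (fun h => ?_) (fun h => ?_) <;> rintro ⟨a, u⟩ rfl ⟨b, v⟩ hb
        · exact Sigma.Lex.left _ _ (h b hb)
        · exact Sigma.Lex.left _ _ (h b hb))
      (hA.mono (by
        rintro ⟨a, u⟩ (h | h)
        · exact (show a = i from h) ▸ hi
        · exact Finset.mem_of_mem_erase h)) (h2 i hij)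
      (fun B hB => hB.minRank_le_of_map (f := Sigma.mk i) (fun _ => rfl)
        fun u v huv => Sigma.Lex.right _ _ huv)
    have h := ih (s.erase i) (Finset.mem_erase.2 ⟨hij.symm, hj⟩) hB
      (by rw [Finset.card_erase_of_mem hi, hc]; rfl)
    rw [← Finset.sum_erase_add s _ hi]
    omega

theorem sum_minRank_le_inv_nJoin {j : Fin n} (h2 : ∀ i, i ≠ j → (D i).minRank ≤ 2) :
    ∑ i, (D i).minRank ≤ (nJoin D).inv := by
  obtain ⟨A, hA, hr⟩ := (nJoin D).exists_straightens_rank_eq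
  exact (sum_minRank_le_rank h2 Finset.univ (Finset.mem_univ j)
    (hA.mono (Set.subset_univ _))).trans (hr ▸ (nJoin D).minRank_le_inv)

variable (D) in
theorem exists_family_of_finset (s : Finset (Fin n)) :
    ∃ F : List (Set ((i : Fin n) × V i)), F.length = ∑ i ∈ s, (D i).inv ∧
      (∀ u v, u.1 ≠ v.1 ∨ u.1 ∉ s → gram F u v = 0) ∧
      ∀ i ∈ s, (D i).Straightens Set.univ ((gram F).submatrix (Sigma.mk i) (Sigma.mk i)) := by
  induction s using Finset.induction_on with
  | empty => exact ⟨[], by simp, fun _ _ _ => rfl, by simp⟩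
  | insert i s hi ih =>
    obtain ⟨F, hF, hF0, hF1⟩ := ih
    obtain ⟨E, hE, hE1⟩ := (D i).exists_gram_straightens
    have hE0 : ∀ u v, u.1 ≠ i → gram (E.map (Sigma.mk i '' ·)) u v = 0 := fun u v hu =>
      gram_map_image_eq_zero _ _ (by rintro ⟨w, rfl⟩; exact hu rfl) v
    refine ⟨E.map (Sigma.mk i '' ·) ++ F, ?_, fun u v huv => ?_, fun k hk => ?_⟩
    · rw [List.length_append, List.length_map, hE, hF, Finset.sum_insert hi]
    · rw [gram_append, Matrix.add_apply]
      by_cases hu : u.1 = i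
      · have hv : v.1 ≠ i := by
          rintro hv
          simp_all
        rw [(gram_isSymm _).apply v u, hE0 v u hv, hF0 u v (Or.inr (hu ▸ hi)), add_zero]
      · rw [hE0 u v hu, hF0 u v (by simp_all), add_zero]
    · rw [gram_append, submatrix_add]
      by_cases hki : k = i
      · subst hki
        have h0 : (gram F).submatrix (Sigma.mk k) (Sigma.mk k) = 0 := by
          ext u v
          exact hF0 _ _ (Or.inr hi)
        change (D k).Straightens _ (_ + (gram F).submatrix (Sigma.mk k) (Sigma.mk k))
        rw [h0, add_zero, gram_map_image_apply sigma_mk_injective]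
        exact hE1
      · have h0 : (gram (E.map (Sigma.mk i '' ·))).submatrix (Sigma.mk k) (Sigma.mk k) = 0 := by
          ext u v
          exact hE0 _ _ hki
        change (D k).Straightens _ ((gram (E.map (Sigma.mk i '' ·))).submatrix _ _ + _)
        rw [h0, zero_add]
        exact hF1 k (Finset.mem_of_mem_insert_of_ne hk hki)

theorem inv_nJoin_le : (nJoin D).inv ≤ ∑ i, (D i).inv := by
  obtain ⟨F, hF, h0, h1⟩ := exists_family_of_finset D Finset.univ
  rw [← hF]
  exact inv_le_length (straightens_nJoin (gram_isSymm F) (fun u v h => h0 u v (Or.inl h))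
    fun i => h1 i (Finset.mem_univ i))

/-- Optimal families for the parts other than `j` are nonempty in total because of part `i`, so they
supply the square that makes an optimal matrix for `D j` cost only its rank. -/
theorem inv_nJoin_le_minRank_add {i j : Fin n} (hij : i ≠ j) (hi : 0 < (D i).inv) :
    (nJoin D).inv ≤ (D j).minRank + ∑ k ∈ Finset.univ.erase j, (D k).inv := by
  obtain ⟨F, hF, h0, h1⟩ := exists_family_of_finset D (Finset.univ.erase j)
  obtain ⟨A, hA, hr⟩ := (D j).exists_straightens_rank_eq
  obtain ⟨B, hB, hBr, hBA, hB0⟩ := exists_zero_extension (Sigma.mk j) sigma_mk_injective hA.1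
  have hB0' : ∀ u v : (i : Fin n) × V i, u.1 ≠ j → B u v = 0 := fun u v hu =>
    hB0 u v (by rintro ⟨w, rfl⟩; exact hu rfl)
  have hne : F ≠ [] := by
    rintro rfl
    have h := Finset.single_le_sum (f := fun k => (D k).inv) (fun _ _ => Nat.zero_le _)
      (Finset.mem_erase.2 ⟨hij, Finset.mem_univ i⟩)
    rw [← hF] at h
    exact absurd hi (not_lt.2 h)
  have hst : (nJoin D).Straightens Set.univ (B + gram F) := by
    refine straightens_nJoin (hB.add (gram_isSymm F)) (fun u v huv => ?_) fun k => ?_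
    · rw [Matrix.add_apply, h0 u v (Or.inl huv), add_zero]
      by_cases hu : u.1 = j
      · rw [hB.apply v u, hB0' v u (hu ▸ huv.symm)]
      · exact hB0' u v hu
    · by_cases hk : k = j
      · subst hk
        have h2 : (B + gram F).submatrix (Sigma.mk k) (Sigma.mk k) = A := by
          ext u v
          rw [← hBA, submatrix_apply, Matrix.add_apply, h0 _ _ (Or.inr (by simp)), add_zero,
            submatrix_apply]
        rw [h2]
        exact hA
      · have h2 : (B + gram F).submatrix (Sigma.mk k) (Sigma.mk k) =
            (gram F).submatrix (Sigma.mk k) (Sigma.mk k) := by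
          ext u v
          rw [submatrix_apply, Matrix.add_apply, hB0' _ _ hk, zero_add, submatrix_apply]
        rw [h2]
        exact h1 k (by simp [hk])
  have h := inv_le_rank_add_length hB hne hst
  omega

end Join

/-! ### Joining a triangle in front -/

section Triangle

theorem one_le_rank_of_straightens_dijoin_C3 {V : Type*} [Fintype V] {G : OrientedGraph V}
    {B : Matrix (Fin 3 ⊕ V) (Fin 3 ⊕ V) (ZMod 2)}
    (hB : (C3.dijoin G).Straightens (Set.range Sum.inl) B) : 1 ≤ B.rank := by
  obtain ⟨-, σ, hσ⟩ := hB
  by_contra h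
  have h0 : B = 0 := eq_zero_of_rank_eq_zero (by omega)
  have key : ∀ u : Fin 3, σ (Sum.inl u) < σ (Sum.inl (u + 1)) := by
    intro u
    obtain ⟨h1, h2⟩ := hσ _ ⟨u, rfl⟩ _ ⟨u + 1, rfl⟩ (Sum.Lex.inl rfl)
    by_contra h3
    rw [h0, if_pos (by omega)] at h2
    exact zero_ne_one h2
  have h1 := key 0
  have h2 := key 1
  have h3 := key 2
  exact lt_irrefl _ (h1.trans (h2.trans h3))

/-- The triangle costs one set, which also provides the spare square for `G`; conversely, stripping
it off lowers the rank by at least one. -/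
theorem inv_C3_dijoin {V : Type*} [Fintype V] (G : OrientedGraph V) :
    (C3.dijoin G).inv = G.minRank + 1 := by
  apply le_antisymm
  · obtain ⟨A, hA, hr⟩ := G.exists_straightens_rank_eq
    obtain ⟨B, hB, hBr, hBA, hB0⟩ := exists_zero_extension (U := Fin 3 ⊕ V) Sum.inr
      Sum.inr_injective hA.1
    obtain ⟨-, σ, hσ⟩ := hA
    have h0 : ∀ u v, B (Sum.inl u) v = 0 := fun u v => hB0 _ _ (by simp)
    have hst : (C3.dijoin G).Straightens Set.univ
        (B + gram [Sum.inl '' ({0, 1} : Set (Fin 3))]) := by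
      -- Inverting `{0, 1}` leaves the triangle ordered 1, 2, 0, and `G` comes after it.
      refine ⟨hB.add (gram_isSymm _), Sum.elim ![2, 0, 1] (fun v => 3 + σ v), ?_⟩
      have hg : ∀ (v : V) w, gram [Sum.inl '' ({0, 1} : Set (Fin 3))] (Sum.inr v) w = 0 := by
        intro v w
        simp [gram, vecMulVec_apply]
      rintro (u | u) - (v | v) - huv
      · have h : v = u + 1 := by simpa [dijoin, C3] using huv
        subst h
        rw [Matrix.add_apply, h0, zero_add]
        fin_cases u <;> simp [gram, vecMulVec_apply, Set.indicator]
      · rw [Matrix.add_apply, h0, zero_add, (gram_isSymm _).apply (Sum.inr v), hg]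
        have h : ∀ u, (![2, 0, 1] : Fin 3 → ℕ) u < 3 + σ v := fun u => by
          fin_cases u <;> simp <;> omega
        exact ⟨(h u).ne, (if_neg (h u).not_gt).symm⟩
      · simp [dijoin] at huv
      · rw [Matrix.add_apply, hg, add_zero]
        have h := hσ u trivial v trivial (by simpa [dijoin] using huv)
        rw [← hBA] at h
        simpa using h
    have h := inv_le_rank_add_length hB (by simp) hst
    simp only [List.length_singleton] at h
    omega
  · obtain ⟨A, hA, hr⟩ := (C3.dijoin G).exists_straightens_rank_eq
    obtain ⟨B, hB, hBA⟩ := exists_straightens_of_forall_adj (S := Set.range Sum.inl)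
      (T := Set.range Sum.inr) (G := C3.dijoin G) (ρ := 1)
      (by
        rintro _ ⟨u, rfl⟩ _ ⟨v, rfl⟩
        exact Sum.Lex.sep u v)
      (hA.mono (Set.subset_univ _)) (by norm_num)
      fun B hB => one_le_rank_of_straightens_dijoin_C3 hB
    have h := hB.minRank_le_of_map (H := G) (f := Sum.inr) (fun w => ⟨w, rfl⟩)
      fun u v huv => Sum.Lex.inr huv
    have h' := (C3.dijoin G).minRank_le_inv
    omega

end Triangle

end OrientedGraph

/-! ### The main theorem -/

theorem theorem1p3 (n : ℕ) (V : Fin n → Type*) [∀ i, Finite (V i)]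
    (D : (i : Fin n) → OrientedGraph (V i)) :
    (2 ≤ n → ∀ j : Fin n, (∀ i : Fin n, i ≠ j → (D i).inv ≤ 2) →
      ((OrientedGraph.nJoin D).inv : ℤ) =
        if (OrientedGraph.C3.dijoin (D j)).inv = (D j).inv ∧ ∃ i : Fin n, i ≠ j ∧ 0 < (D i).inv then
          (∑ i : Fin n, ((D i).inv : ℤ)) - 1
        else
          ∑ i : Fin n, ((D i).inv : ℤ)) ∧
    ((∀ i : Fin n, (D i).inv ≤ 2) → (OrientedGraph.nJoin D).inv = ∑ i : Fin n, (D i).inv) := by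
  have : ∀ i, Fintype (V i) := fun i => Fintype.ofFinite _
  have hle := OrientedGraph.inv_nJoin_le (D := D)
  constructor
  · intro _ j hj
    have hsum := Finset.add_sum_erase Finset.univ (fun i => (D i).inv) (Finset.mem_univ j)
    have hsum' := Finset.add_sum_erase Finset.univ (fun i => (D i).minRank) (Finset.mem_univ j)
    have heq : ∑ i ∈ Finset.univ.erase j, (D i).minRank = ∑ i ∈ Finset.univ.erase j, (D i).inv :=
      Finset.sum_congr rfl fun i hi =>
        OrientedGraph.minRank_eq_inv (hj i (Finset.ne_of_mem_erase hi))
    have hlow := OrientedGraph.sum_minRank_le_inv_nJoin (D := D) (j := j)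
      fun i hi => ((D i).minRank_le_inv).trans (hj i hi)
    have h1 := (D j).minRank_le_inv
    have h2 := (D j).inv_le_minRank_add_one
    rw [OrientedGraph.inv_C3_dijoin, ← Nat.cast_sum]
    by_cases hex : ∃ i : Fin n, i ≠ j ∧ 0 < (D i).inv
    · obtain ⟨i, hij, hi⟩ := id hex
      have hup := OrientedGraph.inv_nJoin_le_minRank_add hij hi
      split_ifs with h
      · have h3 := h.1
        omega
      · have h3 : (D j).minRank + 1 ≠ (D j).inv := fun h3 => h ⟨h3, hex⟩
        omega
    · rw [if_neg fun h => hex h.2]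
      have h0 : ∑ i ∈ Finset.univ.erase j, (D i).inv = 0 := Finset.sum_eq_zero fun i hi => by
        by_contra h
        exact hex ⟨i, Finset.ne_of_mem_erase hi, Nat.pos_of_ne_zero h⟩
      -- With all other parts acyclic no spare square exists, and the rank bound may be one too
      -- small; monotonicity under the inclusion of `D j` gives the exact value.
      have h3 := OrientedGraph.inv_le_of_map (G := OrientedGraph.nJoin D) (H := D j) (Sigma.mk j)
        fun u v huv => Sigma.Lex.right _ _ huv
      omega
  · intro h2
    obtain rfl | hn := Nat.eq_zero_or_pos n
    · simpa using hle
    · refine le_antisymm hle ?_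
      have h := OrientedGraph.sum_minRank_le_inv_nJoin (D := D) (j := ⟨0, hn⟩)
        fun i _ => ((D i).minRank_le_inv).trans (h2 i)
      rwa [Finset.sum_congr rfl fun i _ => OrientedGraph.minRank_eq_inv (h2 i)] at h
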